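/- Let $\mathbb{K}$ be $\mathbb{R}$ or $\mathbb{C}$. By an irreducible (real) algebraic space curve we mean a set $\mathcal{C}\subset\mathbb{K}^3$ that is the common zero set of a set of polynomials in $\mathbb{R}[x,y,z]$, such that the ideal $I(\mathcal{C})\subset\mathbb{R}[x,y,z]$ of all real polynomials vanishing on $\mathcal{C}$ is prime and $\mathbb{R}[x,y,z]/I(\mathcal{C})$ has Krull dimension $1$. (For $\mathbb{K}=\mathbb{R}$ this is a real curve given by its real points; for $\mathbb{K}=\mathbb{C}$ it is a curve defined over $\mathbb{R}$ and irreducible over $\mathbb{R}$, given by its complex points.) Let $\mathcal{C}_1,\mathcal{C}_2\subset\mathbb{K}^3$ be irreducible algebraic space curves, neither of which is a union of concurrent lines of $\mathbb{K}^3$ or a union of parallel lines of $\mathbb{K}^3$ (a single line counts as such a union). For $i=1,2$ let $f_i(\boldsymbol{x})=\lambda_i\boldsymbol{Q}_i\boldsymbol{x}+\boldsymbol{b}_i$ be a similarity, where $0\neq\lambda_i\in\mathbb{R}$, $\boldsymbol{b}_i\in\mathbb{R}^3$, and $\boldsymbol{Q}_i\in\mathbb{R}^{3\times 3}$ satisfies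 $\boldsymbol{Q}_i^{\mathrm T}\boldsymbol{Q}_i=\boldsymbol{I}$ and $\det\boldsymbol{Q}_i=1$, and suppose that $f_1(\mathcal{C}_1)=\mathcal{C}_2$ and $f_2(\mathcal{C}_1)=\mathcal{C}_2$. Then $|\lambda_1|=|\lambda_2|$. -/

import Mathlib

/-- An irreducible (real) algebraic space curve, as a set `C` of points of `𝕜³` where `𝕜` is `ℝ`
(real points) or `ℂ` (complex points): `C` is the common zero set of the real polynomials in three
variables that vanish on it, these polynomials form a prime ideal of `ℝ[x, y, z]`, and the
coordinate ring of `C` has dimension one. -/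
structure IsIrreducibleSpaceCurve {𝕜 : Type*} [RCLike 𝕜] (C : Set (Fin 3 → 𝕜)) : Prop where
  algebraic : MvPolynomial.zeroLocus 𝕜 (MvPolynomial.vanishingIdeal ℝ C) = C
  irreducible : (MvPolynomial.vanishingIdeal ℝ C).IsPrime
  dim_eq_one :
    ringKrullDim (MvPolynomial (Fin 3) ℝ ⧸ MvPolynomial.vanishingIdeal ℝ C) = 1

/-- An affine line in `𝕜³`. -/
def IsLine {𝕜 : Type*} [RCLike 𝕜] (ℓ : AffineSubspace 𝕜 (Fin 3 → 𝕜)) : Prop :=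
  (ℓ : Set (Fin 3 → 𝕜)).Nonempty ∧ Module.finrank 𝕜 ℓ.direction = 1

/-- `C` is a union of lines of `𝕜³` through a common point. -/
def IsUnionOfConcurrentLines {𝕜 : Type*} [RCLike 𝕜] (C : Set (Fin 3 → 𝕜)) : Prop :=
  ∃ (c : Fin 3 → 𝕜) (L : Set (AffineSubspace 𝕜 (Fin 3 → 𝕜))),
    (∀ ℓ ∈ L, IsLine ℓ ∧ c ∈ ℓ) ∧ C = ⋃ ℓ ∈ L, (ℓ : Set (Fin 3 → 𝕜))

/-- `C` is a union of pairwise parallel lines of `𝕜³`. -/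
def IsUnionOfParallelLines {𝕜 : Type*} [RCLike 𝕜] (C : Set (Fin 3 → 𝕜)) : Prop :=
  ∃ L : Set (AffineSubspace 𝕜 (Fin 3 → 𝕜)),
    (∀ ℓ ∈ L, IsLine ℓ) ∧ (∀ ℓ ∈ L, ∀ m ∈ L, ℓ.Parallel m) ∧
      C = ⋃ ℓ ∈ L, (ℓ : Set (Fin 3 → 𝕜))

/-- The map `x ↦ r Q x + b` of `𝕜³`, with `r`, `Q` and `b` real; for `r ≠ 0` it is a similarity
with signed ratio `r`. -/
noncomputable def similarityMap (𝕜 : Type*) [RCLike 𝕜] (r : ℝ)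
    (Q : Matrix.specialOrthogonalGroup (Fin 3) ℝ) (b : Fin 3 → ℝ) (x : Fin 3 → 𝕜) : Fin 3 → 𝕜 :=
  (r : 𝕜) • (((Q : Matrix (Fin 3) (Fin 3) ℝ).map (fun a : ℝ => (a : 𝕜))).mulVec x)
    + fun i => (b i : 𝕜)

open Filter Topology MvPolynomial Matrix

/-! If the ratios differed in absolute value, one of `f₂⁻¹ ∘ f₁`, `f₁⁻¹ ∘ f₂` would be a contraction
`c + v ↦ c + r Q v` about a real fixed point `c`, mapping `C₁` into itself. For `c + v` in `C₁` and
`p` vanishing on `C₁`, write `p (c + t w) = ∑ q_d(w) t ^ d`; the orbit gives `∑ q_d(Q ^ k v) (r ^ k)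
^ d = 0` for all `k`. Since `r ^ k → 0` while `Q ^ k` recurs in the compact orthogonal group, every
`q_d(v)` is zero (`coeff_eq_zero_of_sum_pow_eq_zero`). Hence `C₁` is a cone with vertex `c`, which
is excluded. -/

theorem isCompact_unitaryGroup (n : Type*) [Fintype n] [DecidableEq n] (𝕜 : Type*) [RCLike 𝕜] :
    IsCompact (unitaryGroup n 𝕜 : Set (Matrix n n 𝕜)) := by
  have hK : IsCompact
      (Set.univ.pi fun _ => Set.univ.pi fun _ => Metric.closedBall 0 1 : Set (n → n → 𝕜)) :=
    isCompact_univ_pi fun _ => isCompact_univ_pi fun _ => isCompact_closedBall _ _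
  refine IsCompact.of_isClosed_subset (s := (_ : Set (Matrix n n 𝕜))) hK ?_ ?_
  · have : (unitaryGroup n 𝕜 : Set (Matrix n n 𝕜)) = {A | A * star A = 1} := by
      ext A
      exact mem_unitaryGroup_iff
    rw [this]
    exact isClosed_eq (by fun_prop) continuous_const
  · intro U hU i _ j _
    simpa using entry_norm_bound_of_unitary hU i j

/-- If a power series in `r ^ k`, `0 < |r| < 1`, whose coefficients are continuous functions of
`g ^ k` in a compact group, vanishes for all `k`, then so does every coefficient. -/
theorem coeff_eq_zero_of_sum_pow_eq_zero {G 𝕜 : Type*} [Group G] [TopologicalSpace G]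
    [IsTopologicalGroup G] [CompactSpace G] [NormedField 𝕜] {r : 𝕜} (hr0 : r ≠ 0) (hr : ‖r‖ < 1)
    (g : G) (N : ℕ) (F : ℕ → G → 𝕜) (hF : ∀ d, Continuous (F d))
    (h : ∀ k : ℕ, ∑ d ∈ Finset.range N, F d (g ^ k) * (r ^ k) ^ d = 0) :
    ∀ d < N, ∀ m : ℕ, F d (g ^ m) = 0 := by
  intro d
  induction d using Nat.strong_induction_on with
  | _ d ih =>
  intro hd m
  have hbd : ∀ e, ∃ B, ∀ x, ‖F e x‖ ≤ B := fun e => by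
    obtain ⟨B, hB⟩ := isCompact_univ.exists_bound_of_continuousOn (hF e).continuousOn
    exact ⟨B, fun x => hB x trivial⟩
  have hpow : Tendsto (fun k : ℕ => r ^ k) atTop (𝓝 0) :=
    tendsto_pow_atTop_nhds_zero_of_norm_lt_one hr
  -- The terms below `d` vanish by induction, so `(r ^ k) ^ d` can be cancelled; what remains on the
  -- right tends to zero.
  have key : ∀ k : ℕ, F d (g ^ k)
      = -∑ e ∈ Finset.Ico (d + 1) N, F e (g ^ k) * (r ^ k) ^ (e - d) := by
    intro k
    have h1 := h k
    rw [← Finset.sum_range_add_sum_Ico _ hd.le, Finset.sum_eq_zero, zero_add,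
      Finset.sum_eq_sum_Ico_succ_bot hd] at h1
    · have h2 : ∑ e ∈ Finset.Ico (d + 1) N, F e (g ^ k) * (r ^ k) ^ e
          = (∑ e ∈ Finset.Ico (d + 1) N, F e (g ^ k) * (r ^ k) ^ (e - d)) * (r ^ k) ^ d := by
        rw [Finset.sum_mul]
        refine Finset.sum_congr rfl fun e he => ?_
        rw [mul_assoc, ← pow_add, Nat.sub_add_cancel (by simp at he; omega)]
      rw [h2, ← add_mul] at h1
      exact eq_neg_of_add_eq_zero_left
        ((mul_eq_zero.mp h1).resolve_right (pow_ne_zero _ (pow_ne_zero _ hr0)))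
    · intro e he
      have he' := Finset.mem_range.mp he
      rw [ih e he' (he'.trans hd) k, zero_mul]
  have hlim : Tendsto (fun k : ℕ => F d (g ^ k)) atTop (𝓝 0) := by
    simp_rw [key]
    rw [← neg_zero, ← Finset.sum_const_zero (s := Finset.Ico (d + 1) N)]
    refine (tendsto_finsetSum _ fun e he => ?_).neg
    obtain ⟨B, hB⟩ := hbd e
    have he' : e - d ≠ 0 := by simp at he; omega
    have h0 : Tendsto (fun k : ℕ => (r ^ k) ^ (e - d)) atTop (𝓝 0) := by
      simpa [he'] using hpow.pow (e - d)
    exact isBoundedUnder_le_mul_tendsto_zero (isBoundedUnder_of ⟨B, fun k => hB _⟩) h0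
  -- Recurrence: in a compact group `g ^ m` is a cluster point of the positive powers of `g`.
  have hcl : MapClusterPt (F d (g ^ m)) atTop (fun k : ℕ => F d (g ^ k)) := by
    have := (mapClusterPt_self_zpow_atTop_pow g m).continuousAt_comp (hF d).continuousAt
    simpa [Function.comp_def] using this
  have : (𝓝 (F d (g ^ m)) ⊓ 𝓝 0).NeBot := hcl.clusterPt.mono hlim
  exact eq_of_nhds_neBot this

/-- The restriction of a polynomial to the lines through `c`, as a polynomial in the parameter of
the line with coefficients that are polynomials in its direction. -/
theorem exists_eval_line_eq_sum {σ R 𝕜 : Type*} [CommRing R] [CommRing 𝕜] [Algebra R 𝕜]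
    (p : MvPolynomial σ R) (c : σ → 𝕜) :
    ∃ (N : ℕ) (q : ℕ → MvPolynomial σ 𝕜), ∀ (v : σ → 𝕜) (t : 𝕜),
      aeval (c + t • v) p = ∑ d ∈ Finset.range N, eval v (q d) * t ^ d := by
  let P : Polynomial (MvPolynomial σ 𝕜) :=
    aeval (fun i => Polynomial.C (C (c i)) + Polynomial.X * Polynomial.C (X i)) p
  refine ⟨P.natDegree + 1, P.coeff, fun v t => ?_⟩
  rw [← Polynomial.eval₂_eq_sum_range (eval v) t]
  have : (Polynomial.eval₂RingHom (eval v) t).comp (aeval (R := R)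
      (fun i => Polynomial.C (C (c i)) + Polynomial.X * Polynomial.C (X i) :
        σ → Polynomial (MvPolynomial σ 𝕜))).toRingHom = (aeval (R := R) (c + t • v)).toRingHom := by
    refine MvPolynomial.ringHom_ext (fun a => ?_) fun i => ?_
    · simp [MvPolynomial.algebraMap_eq,
        IsScalarTower.algebraMap_apply R (MvPolynomial σ 𝕜) (Polynomial (MvPolynomial σ 𝕜)),
        IsScalarTower.algebraMap_apply R 𝕜 (MvPolynomial σ 𝕜)]
    · simp [mul_comm t (v i)]
  exact (RingHom.congr_fun this p).symm

/-- The real matrix `A` acting on `𝕜ⁿ`. -/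
noncomputable def realAct {n : Type*} [Fintype n] (𝕜 : Type*) [RCLike 𝕜] (A : Matrix n n ℝ)
    (v : n → 𝕜) : n → 𝕜 :=
  (A.map (fun a : ℝ => (a : 𝕜))).mulVec v

theorem realAct_mul {n : Type*} [Fintype n] {𝕜 : Type*} [RCLike 𝕜] (A B : Matrix n n ℝ)
    (v : n → 𝕜) : realAct 𝕜 (A * B) v = realAct 𝕜 A (realAct 𝕜 B v) := by
  have : (A * B).map (fun a : ℝ => (a : 𝕜))
      = A.map (fun a : ℝ => (a : 𝕜)) * B.map fun a => (a : 𝕜) :=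
    Matrix.map_mul (f := algebraMap ℝ 𝕜)
  rw [realAct, this, realAct, realAct, mulVec_mulVec]

theorem realAct_one {n : Type*} [Fintype n] [DecidableEq n] {𝕜 : Type*} [RCLike 𝕜]
    (v : n → 𝕜) : realAct 𝕜 1 v = v := by
  simp [realAct]

theorem realAct_add {n : Type*} [Fintype n] {𝕜 : Type*} [RCLike 𝕜] (A : Matrix n n ℝ)
    (v w : n → 𝕜) : realAct 𝕜 A (v + w) = realAct 𝕜 A v + realAct 𝕜 A w :=
  mulVec_add _ _ _

theorem realAct_smul {n : Type*} [Fintype n] {𝕜 : Type*} [RCLike 𝕜] (A : Matrix n n ℝ)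
    (t : 𝕜) (v : n → 𝕜) : realAct 𝕜 A (t • v) = t • realAct 𝕜 A v :=
  mulVec_smul _ _ _

theorem realAct_ofReal {n : Type*} [Fintype n] {𝕜 : Type*} [RCLike 𝕜] (A : Matrix n n ℝ)
    (w : n → ℝ) : realAct 𝕜 A (fun i => (w i : 𝕜)) = fun i => ((A.mulVec w i : ℝ) : 𝕜) := by
  ext i
  simp [realAct, mulVec, dotProduct]

theorem continuous_realAct {n : Type*} [Fintype n] {𝕜 : Type*} [RCLike 𝕜] (v : n → 𝕜) :
    Continuous fun A : Matrix n n ℝ => realAct 𝕜 A v := by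
  unfold realAct
  exact (continuous_id.matrix_map RCLike.continuous_ofReal).matrix_mulVec continuous_const

/-- A zero locus that is invariant under a linear contraction `r • Q` about `c` with `Q` orthogonal
is a cone with vertex `c`. -/
theorem add_smul_mem_of_invariant {n : Type*} [Fintype n] [DecidableEq n] {𝕜 : Type*} [RCLike 𝕜]
    {C : Set (n → 𝕜)} (hC : zeroLocus 𝕜 (vanishingIdeal ℝ C) = C) {r : ℝ} (hr0 : r ≠ 0)
    (hr : |r| < 1) (Q : unitaryGroup n ℝ) (c : n → 𝕜)
    (hinv : ∀ v, c + v ∈ C → c + (r : 𝕜) • realAct 𝕜 (Q : Matrix n n ℝ) v ∈ C) {v : n → 𝕜}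
    (hv : c + v ∈ C) (t : 𝕜) : c + t • v ∈ C := by
  have hiter : ∀ k : ℕ, c + ((r : 𝕜) ^ k) •
      realAct 𝕜 ((Q ^ k : unitaryGroup n ℝ) : Matrix n n ℝ) v ∈ C := by
    intro k
    induction k with
    | zero => simpa [realAct_one] using hv
    | succ k ih =>
      convert! hinv _ ih using 2
      rw [realAct_smul, ← realAct_mul, smul_smul, ← pow_succ', pow_succ' Q]
      rfl
  rw [← hC]
  intro p hp
  obtain ⟨N, q, hq⟩ := exists_eval_line_eq_sum p c
  have : CompactSpace (unitaryGroup n ℝ) :=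
    isCompact_iff_compactSpace.mp (isCompact_unitaryGroup n ℝ)
  have hzero := coeff_eq_zero_of_sum_pow_eq_zero (𝕜 := 𝕜) (r := (r : 𝕜)) (by exact_mod_cast hr0)
    (by simpa using hr) Q N (fun d A => eval (realAct 𝕜 (A : Matrix n n ℝ) v) (q d))
    (fun d => (MvPolynomial.continuous_eval _).comp
      ((continuous_realAct v).comp continuous_subtype_val))
    (fun k => by rw [← hq]; exact hp _ (hiter k))
  rw [hq]
  refine Finset.sum_eq_zero fun d hd => ?_
  -- The exponent `0` gives the coefficients at `v` itself.
  have := hzero d (Finset.mem_range.mp hd) 0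
  simp only [pow_zero, OneMemClass.coe_one, realAct_one] at this
  rw [this, zero_mul]

/-- `1 - r Q` is invertible: `v = r Q v` gives `v ⬝ᵥ v = r ^ 2 * (v ⬝ᵥ v)`, as `Q` preserves the dot
product. -/
theorem exists_fixedPoint {n : Type*} [Fintype n] [DecidableEq n] {r : ℝ} (hr : |r| < 1)
    (Q : unitaryGroup n ℝ) (b : n → ℝ) :
    ∃ c : n → ℝ, c = r • (Q : Matrix n n ℝ).mulVec c + b := by
  have hinj : Function.Injective (1 - r • (Q : Matrix n n ℝ)).mulVec := by
    refine (injective_iff_map_eq_zero (mulVecLin (1 - r • (Q : Matrix n n ℝ)))).mpr fun v hv => ?_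
    rw [mulVecLin_apply, sub_mulVec, one_mulVec, smul_mulVec, sub_eq_zero] at hv
    have hQ : (Q : Matrix n n ℝ)ᵀ * Q = 1 := by
      simpa [star_eq_conjTranspose, conjTranspose_eq_transpose_of_trivial] using Q.2.1
    have hiso : (Q : Matrix n n ℝ).mulVec v ⬝ᵥ (Q : Matrix n n ℝ).mulVec v = v ⬝ᵥ v := by
      rw [dotProduct_mulVec, ← mulVec_transpose, mulVec_mulVec, hQ, one_mulVec]
    have h1 : v ⬝ᵥ v = r ^ 2 * (v ⬝ᵥ v) := by
      conv_lhs => rw [hv]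
      rw [smul_dotProduct, dotProduct_smul, hiso, smul_smul, smul_eq_mul, sq]
    have h2 : r ^ 2 < 1 := (sq_lt_one_iff_abs_lt_one r).mpr hr
    have h3 : (1 - r ^ 2) * (v ⬝ᵥ v) = 0 := by linarith
    exact dotProduct_self_eq_zero.mp ((mul_eq_zero.mp h3).resolve_left (by linarith))
  have hsurj : Function.Surjective (1 - r • (Q : Matrix n n ℝ)).mulVec :=
    mulVec_surjective_iff_isUnit.mpr (mulVec_injective_iff_isUnit.mp hinj)
  obtain ⟨c, hc⟩ := hsurj b
  refine ⟨c, ?_⟩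
  rw [sub_mulVec, one_mulVec, smul_mulVec] at hc
  rw [← hc, add_sub_cancel]

theorem IsIrreducibleSpaceCurve.nonempty {𝕜 : Type*} [RCLike 𝕜] {C : Set (Fin 3 → 𝕜)}
    (hC : IsIrreducibleSpaceCurve C) : C.Nonempty := by
  rw [Set.nonempty_iff_ne_empty]
  rintro rfl
  exact hC.irreducible.ne_top vanishingIdeal_empty

/-- The ideal of a real point is maximal, so the coordinate ring would be a field, of dimension
zero. -/
theorem IsIrreducibleSpaceCurve.ne_singleton_ofReal {𝕜 : Type*} [RCLike 𝕜] {C : Set (Fin 3 → 𝕜)}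
    (hC : IsIrreducibleSpaceCurve C) (c : Fin 3 → ℝ) : C ≠ {fun i => (c i : 𝕜)} := by
  rintro rfl
  have hI : vanishingIdeal ℝ {fun i => (c i : 𝕜)} = vanishingIdeal ℝ {c} := by
    ext p
    rw [mem_vanishingIdeal_singleton_iff, mem_vanishingIdeal_singleton_iff]
    have := MvPolynomial.aeval_algebraMap_apply (R := ℝ) 𝕜 c p
    simp only [Function.comp_def] at this
    erw [this]
    simp
  have hdim := hC.dim_eq_one
  rw [hI] at hdim
  let := Ideal.Quotient.field (vanishingIdeal ℝ {c})
  rw [ringKrullDim_eq_zero_of_field] at hdim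
  exact zero_ne_one hdim

/-- A curve that is a cone over a real point is a union of lines through that point. -/
theorem IsIrreducibleSpaceCurve.isUnionOfConcurrentLines {𝕜 : Type*} [RCLike 𝕜]
    {C : Set (Fin 3 → 𝕜)} (hC : IsIrreducibleSpaceCurve C) (a : Fin 3 → ℝ)
    (hcone : ∀ v, (fun i => (a i : 𝕜)) + v ∈ C → ∀ t : 𝕜, (fun i => (a i : 𝕜)) + t • v ∈ C) :
    IsUnionOfConcurrentLines C := by
  set c : Fin 3 → 𝕜 := fun i => (a i : 𝕜) with hc
  -- Needed to put the vertex itself on one of the lines.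
  have hex : ∃ v, v ≠ 0 ∧ c + v ∈ C := by
    by_contra! hno
    refine hC.ne_singleton_ofReal a (hC.nonempty.subset_singleton_iff.mp fun x hx => ?_)
    by_contra hxc
    exact hno (x - c) (sub_ne_zero.mpr hxc) (by simpa using hx)
  refine ⟨c, {ℓ | ∃ v, v ≠ 0 ∧ c + v ∈ C ∧ ℓ = AffineSubspace.mk' c (𝕜 ∙ v)}, ?_, ?_⟩
  · rintro _ ⟨v, hv, -, rfl⟩
    refine ⟨⟨⟨c, AffineSubspace.self_mem_mk' _ _⟩, ?_⟩, AffineSubspace.self_mem_mk' _ _⟩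
    rw [AffineSubspace.direction_mk', finrank_span_singleton hv]
  · ext x
    simp only [Set.mem_iUnion, SetLike.mem_coe, exists_prop]
    constructor
    · intro hx
      by_cases hxc : x = c
      · obtain ⟨v, hv, hvC⟩ := hex
        exact ⟨_, ⟨v, hv, hvC, rfl⟩, hxc ▸ AffineSubspace.self_mem_mk' _ _⟩
      · exact ⟨_, ⟨x - c, sub_ne_zero.mpr hxc, by simpa using hx, rfl⟩, by
          rw [AffineSubspace.mem_mk']; exact Submodule.mem_span_singleton_self _⟩
    · rintro ⟨_, ⟨v, -, hvC, rfl⟩, hx⟩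
      rw [AffineSubspace.mem_mk', Submodule.mem_span_singleton] at hx
      obtain ⟨t, ht⟩ := hx
      have : x = c + t • v := by rw [ht]; simp
      exact this ▸ hcone v hvC t

theorem isUnionOfConcurrentLines_of_abs_lt {𝕜 : Type*} [RCLike 𝕜] {C₁ C₂ : Set (Fin 3 → 𝕜)}
    (hC₁ : IsIrreducibleSpaceCurve C₁) {r₁ r₂ : ℝ} (hr₁ : r₁ ≠ 0) (hr₂ : r₂ ≠ 0)
    {Q₁ Q₂ : Matrix.specialOrthogonalGroup (Fin 3) ℝ} {b₁ b₂ : Fin 3 → ℝ}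
    (h₁ : similarityMap 𝕜 r₁ Q₁ b₁ '' C₁ = C₂) (h₂ : similarityMap 𝕜 r₂ Q₂ b₂ '' C₁ = C₂)
    (hlt : |r₁| < |r₂|) : IsUnionOfConcurrentLines C₁ := by
  let U₁ : unitaryGroup (Fin 3) ℝ := ⟨Q₁, (mem_specialOrthogonalGroup_iff.mp Q₁.2).1⟩
  let U₂ : unitaryGroup (Fin 3) ℝ := ⟨Q₂, (mem_specialOrthogonalGroup_iff.mp Q₂.2).1⟩
  let Q : unitaryGroup (Fin 3) ℝ := U₂⁻¹ * U₁
  have hQ : (Q₂ : Matrix (Fin 3) (Fin 3) ℝ) * Q = Q₁ :=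
    congrArg Subtype.val (mul_inv_cancel_left U₂ U₁)
  have hQ₂ : ((U₂⁻¹ : unitaryGroup (Fin 3) ℝ) : Matrix (Fin 3) (Fin 3) ℝ) * Q₂ = 1 :=
    congrArg Subtype.val (inv_mul_cancel U₂)
  have hQ₂' : (Q₂ : Matrix (Fin 3) (Fin 3) ℝ) * ((U₂⁻¹ : unitaryGroup (Fin 3) ℝ) :
      Matrix (Fin 3) (Fin 3) ℝ) = 1 := congrArg Subtype.val (mul_inv_cancel U₂)
  have hinj : Function.Injective (similarityMap 𝕜 r₂ Q₂ b₂) := by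
    intro x y hxy
    have h := smul_right_injective _ (RCLike.ofReal_ne_zero.mpr hr₂) (add_right_cancel hxy)
    have h' := congrArg (realAct 𝕜 ((U₂⁻¹ : unitaryGroup (Fin 3) ℝ) : Matrix _ _ ℝ)) h
    change realAct 𝕜 _ (realAct 𝕜 _ x) = realAct 𝕜 _ (realAct 𝕜 _ y) at h'
    rwa [← realAct_mul, ← realAct_mul, hQ₂, realAct_one, realAct_one] at h'
  have hr : |r₁ / r₂| < 1 := by
    rw [abs_div]
    exact (div_lt_one (abs_pos.mpr hr₂)).mpr hlt
  -- The vector supplied is the translation part of `f₂⁻¹ ∘ f₁`, whose linear part is `(r₁ / r₂) Q`.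
  obtain ⟨a, ha⟩ := exists_fixedPoint hr Q
    (r₂⁻¹ • ((U₂⁻¹ : unitaryGroup (Fin 3) ℝ) : Matrix (Fin 3) (Fin 3) ℝ).mulVec (b₁ - b₂))
  refine hC₁.isUnionOfConcurrentLines a fun v hv t =>
    add_smul_mem_of_invariant hC₁.algebraic (div_ne_zero hr₁ hr₂) hr Q _ (fun w hw => ?_) hv t
  have ha' : r₂ • (Q₂ : Matrix (Fin 3) (Fin 3) ℝ).mulVec a + b₂
      = r₁ • (Q₁ : Matrix (Fin 3) (Fin 3) ℝ).mulVec a + b₁ := by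
    conv_lhs => rw [ha]
    rw [mulVec_add, mulVec_smul, mulVec_smul, mulVec_mulVec, mulVec_mulVec, hQ, hQ₂', one_mulVec,
      smul_add, smul_smul, smul_smul, mul_div_cancel₀ _ hr₂, mul_inv_cancel₀ hr₂, one_smul,
      add_assoc, sub_add_cancel]
  obtain ⟨y, hy, hyw⟩ : similarityMap 𝕜 r₁ Q₁ b₁ ((fun i => (a i : 𝕜)) + w)
      ∈ similarityMap 𝕜 r₂ Q₂ b₂ '' C₁ := h₂ ▸ h₁ ▸ Set.mem_image_of_mem _ hw
  convert hy
  refine hinj (Eq.trans ?_ hyw.symm)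
  change (r₂ : 𝕜) • realAct 𝕜 _ _ + _ = (r₁ : 𝕜) • realAct 𝕜 _ _ + _
  have hr' : (r₂ : 𝕜) * ((r₁ / r₂ : ℝ) : 𝕜) = r₁ := by
    rw [← RCLike.ofReal_mul, mul_div_cancel₀ _ hr₂]
  rw [realAct_add, realAct_add, realAct_smul, ← realAct_mul, hQ, realAct_ofReal, realAct_ofReal, smul_add, smul_add,
    smul_smul, hr']
  ext i
  have hi : (r₂ : 𝕜) * (((Q₂ : Matrix (Fin 3) (Fin 3) ℝ).mulVec a i : ℝ) : 𝕜) + b₂ i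
      = (r₁ : 𝕜) * (((Q₁ : Matrix (Fin 3) (Fin 3) ℝ).mulVec a i : ℝ) : 𝕜) + b₁ i := by
    exact_mod_cast congrFun ha' i
  simp only [Pi.add_apply, Pi.smul_apply, smul_eq_mul]
  linear_combination hi

theorem mainTheorem7 {𝕜 : Type*} [RCLike 𝕜] (C₁ C₂ : Set (Fin 3 → 𝕜))
    (hC₁ : IsIrreducibleSpaceCurve C₁) (hC₂ : IsIrreducibleSpaceCurve C₂)
    (hconc₁ : ¬ IsUnionOfConcurrentLines C₁) (hpar₁ : ¬ IsUnionOfParallelLines C₁)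
    (hconc₂ : ¬ IsUnionOfConcurrentLines C₂) (hpar₂ : ¬ IsUnionOfParallelLines C₂)
    (r₁ r₂ : ℝ) (hr₁ : r₁ ≠ 0) (hr₂ : r₂ ≠ 0)
    (Q₁ Q₂ : Matrix.specialOrthogonalGroup (Fin 3) ℝ) (b₁ b₂ : Fin 3 → ℝ)
    (h₁ : similarityMap 𝕜 r₁ Q₁ b₁ '' C₁ = C₂)
    (h₂ : similarityMap 𝕜 r₂ Q₂ b₂ '' C₁ = C₂) :
    |r₁| = |r₂| := by
  rcases lt_trichotomy |r₁| |r₂| with hlt | heq | hgt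
  · exact absurd (isUnionOfConcurrentLines_of_abs_lt hC₁ hr₁ hr₂ h₁ h₂ hlt) hconc₁
  · exact heq
  · exact absurd (isUnionOfConcurrentLines_of_abs_lt hC₁ hr₂ hr₁ h₂ h₁ hgt) hconc₁
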